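/- Let $n\ge 1$. A rank-one quantum game with finite-dimensional registers $\mathcal H_A,\mathcal H_B,\mathcal H_C$ is given by unit vectors $|\psi\rangle,|\gamma\rangle\in\mathcal H_A\otimes\mathcal H_B\otimes\mathcal H_C$. The referee prepares $|\psi\rangle$, keeps $C$, sends $A$ to Alice and $B$ to Bob, receives these registers back, and measures $ABC$ with $\{|\gamma\rangle\langle\gamma|,\,1-|\gamma\rangle\langle\gamma|\}$; the players win if the outcome is $|\gamma\rangle\langle\gamma|$. The game has local dimension $n$ if $\mathcal H_A=\mathcal H_B=\mathbb C^n$. A quantum operation on a finite-dimensional Hilbert space is a completely positive trace-preserving linear map. For a rank-one quantum game $G$: * $\omega^*(G)$ is the supremum of the winning probabilities when the players share a state $|\varphi\rangle\in\mathcal H_{A'}\otimes\mathcal H_{B'}$ (any finite dimensions), Alice applies a quantum operation to $\mathcal H_A\otimes\mathcal H_{A'}$ and Bob one to $\mathcal H_B\otimes\mathcal H_{B'}$; * $\omega_{qow}(G)$ is the supremum of the winning probabilities when an auxiliary register $A'$ (any finite dimension) starts in a fixed state $|0\rangle$, Alice applies a quantum operation to $\mathcal H_A\otimes\mathcal H_{A'}$,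 and then Bob applies one to $\mathcal H_B\otimes\mathcal H_{A'}$; * $V(G)$ is the supremum of the winning probabilities of a single player who has both $A$ and $B$ and an auxiliary register $E$ (any finite dimension) in a state of his choice, and applies a quantum operation to $\mathcal H_A\otimes\mathcal H_B\otimes\mathcal H_E$. With $\mathcal H_A=\mathcal H_B=\mathcal H_C=\mathbb C^n$, let $G_C$ be the game with $$|\psi\rangle=\tfrac1{\sqrt n}\sum_{i=1}^n|i\rangle|1\rangle|i\rangle,\qquad |\gamma\rangle=\tfrac1{\sqrt n}\sum_{i=1}^n|1\rangle|i\rangle|i\rangle,$$ and let $G_R$ be the game with $$|\psi\rangle=\tfrac1{\sqrt n}\sum_{i=1}^n|1\rangle|i\rangle|i\rangle,\qquad |\gamma\rangle=\tfrac1{\sqrt n}\sum_{i=1}^n|i\rangle|1\rangle|i\rangle .$$ Theorem. One has $$\frac{\omega_{qow}(G_C)}{\omega^*(G_C)}=n^2\qquad\text{and}\qquad \frac{V(G_R)}{\omega_{qow}(G_R)}=n^2 .$$ These separations are optimal in the dimension of the games: for every rank-one quantum game $G$ of local dimension $n$, with $\mathcal H_C$ of any finite dimension, $$\omega_{qow}(G)\le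 n^2\,\omega^*(G)\qquad\text{and}\qquad V(G)\le n^2\,\omega_{qow}(G).$$ -/

import Mathlib

open scoped ComplexOrder Kronecker

noncomputable section

namespace QuantumGame

section Operations

variable {R E S : Type*}

/-- `onRegister e T` is the map `T ⊗ id_E` acting on the matrices of a composite system `S`, where
`e` displays `S` as the register `R` together with the remaining registers `E`: the map `T` is
applied to each `R`-block of the matrix. -/
def onRegister (e : S ≃ R × E) (T : Matrix R R ℂ →ₗ[ℂ] Matrix R R ℂ) (X : Matrix S S ℂ) :
    Matrix S S ℂ :=
  Matrix.of fun s t =>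
    T (Matrix.of fun i j => X (e.symm (i, (e s).2)) (e.symm (j, (e t).2))) (e s).1 (e t).1

/-- A quantum operation on the register with Hilbert space `ℂ^R`: a completely positive, trace
preserving linear map. -/
structure IsQuantumOperation [Fintype R] (T : Matrix R R ℂ →ₗ[ℂ] Matrix R R ℂ) : Prop where
  completelyPositive : ∀ (k : ℕ) (X : Matrix (R × Fin k) (R × Fin k) ℂ),
    X.PosSemidef → (onRegister (Equiv.refl (R × Fin k)) T X).PosSemidef
  tracePreserving : ∀ X : Matrix R R ℂ, (T X).trace = X.trace

/-- The vector `|v⟩ ⊗ |w⟩`. -/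
def tensorVec {ι κ : Type*} (v : EuclideanSpace ℂ ι) (w : EuclideanSpace ℂ κ) :
    EuclideanSpace ℂ (ι × κ) :=
  WithLp.toLp 2 fun x => v x.1 * w x.2

/-- The operator `|v⟩⟨v|`. -/
def ketBra {ι : Type*} (v : EuclideanSpace ℂ ι) : Matrix ι ι ℂ :=
  Matrix.of fun x y => v x * star (v y)

end Operations

/-- A rank-one quantum game with Alice's, Bob's and the referee's registers `ℂ^A`, `ℂ^B`, `ℂ^C`:
the referee prepares the state `ψ` and, in the end, measures `{|γ⟩⟨γ|, 1 - |γ⟩⟨γ|}`. -/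
structure RankOneGame (A B C : Type*) [Fintype A] [Fintype B] [Fintype C] where
  ψ : EuclideanSpace ℂ (A × B × C)
  γ : EuclideanSpace ℂ (A × B × C)
  norm_ψ : ‖ψ‖ = 1
  norm_γ : ‖γ‖ = 1

section Registers

variable (A B C A' B' E : Type*)

/-- `A A'` against the rest in the system `A B C A' B'`. -/
def splitAliceEnt : (A × B × C) × (A' × B') ≃ (A × A') × (B × C × B') where
  toFun x := ((x.1.1, x.2.1), (x.1.2.1, x.1.2.2, x.2.2))
  invFun y := ((y.1.1, y.2.1, y.2.2.1), (y.1.2, y.2.2.2))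
  left_inv _ := rfl
  right_inv _ := rfl

/-- `B B'` against the rest in the system `A B C A' B'`. -/
def splitBobEnt : (A × B × C) × (A' × B') ≃ (B × B') × (A × C × A') where
  toFun x := ((x.1.2.1, x.2.2), (x.1.1, x.1.2.2, x.2.1))
  invFun y := ((y.2.1, y.1.1, y.2.2.1), (y.2.2.2, y.1.2))
  left_inv _ := rfl
  right_inv _ := rfl

/-- `A A'` against the rest in the system `A B C A'`. -/
def splitAliceOneWay : (A × B × C) × A' ≃ (A × A') × (B × C) where
  toFun x := ((x.1.1, x.2), (x.1.2.1, x.1.2.2))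
  invFun y := ((y.1.1, y.2.1, y.2.2), y.1.2)
  left_inv _ := rfl
  right_inv _ := rfl

/-- `B A'` against the rest in the system `A B C A'`. -/
def splitBobOneWay : (A × B × C) × A' ≃ (B × A') × (A × C) where
  toFun x := ((x.1.2.1, x.2), (x.1.1, x.1.2.2))
  invFun y := ((y.2.1, y.1.1, y.2.2), y.1.2)
  left_inv _ := rfl
  right_inv _ := rfl

/-- `A B E` against the referee's register in the system `A B C E`. -/
def splitJoint : (A × B × C) × E ≃ (A × B × E) × C where
  toFun x := ((x.1.1, x.1.2.1, x.2), x.1.2.2)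
  invFun y := ((y.1.1, y.1.2.1, y.2), y.1.2.2)
  left_inv _ := rfl
  right_inv _ := rfl

end Registers

namespace RankOneGame

variable {A B C : Type*} [Fintype A] [Fintype B] [Fintype C]

/-- The probability `tr((|γ⟩⟨γ| ⊗ 1_E) ρ)` that the referee accepts, when the final state of the
registers `A B C` and of the auxiliary registers `E` is `ρ`. -/
def acceptProb (G : RankOneGame A B C) {E : Type*} [Fintype E] [DecidableEq E]
    (ρ : Matrix ((A × B × C) × E) ((A × B × C) × E) ℂ) : ℝ :=
  ((ketBra G.γ ⊗ₖ (1 : Matrix E E ℂ)) * ρ).trace.re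

/-- The set of winning probabilities of strategies with shared entanglement: the players share a
state `φ ∈ ℂ^k ⊗ ℂ^l`, Alice applies a quantum operation to `A A'` and Bob one to `B B'`. -/
def entangledProbs (G : RankOneGame A B C) : Set ℝ :=
  {p | ∃ (k l : ℕ) (φ : EuclideanSpace ℂ (Fin k × Fin l))
      (T : Matrix (A × Fin k) (A × Fin k) ℂ →ₗ[ℂ] Matrix (A × Fin k) (A × Fin k) ℂ)
      (S : Matrix (B × Fin l) (B × Fin l) ℂ →ₗ[ℂ] Matrix (B × Fin l) (B × Fin l) ℂ),
      ‖φ‖ = 1 ∧ IsQuantumOperation T ∧ IsQuantumOperation S ∧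
      p = G.acceptProb
        (onRegister (splitAliceEnt A B C (Fin k) (Fin l)) T
          (onRegister (splitBobEnt A B C (Fin k) (Fin l)) S (ketBra (tensorVec G.ψ φ))))}

/-- The entangled value `ω*(G)`. -/
def entangledValue (G : RankOneGame A B C) : ℝ := sSup G.entangledProbs

/-- The set of winning probabilities of strategies with one-way quantum communication: an
auxiliary register `A'` of dimension `k + 1` starts in the state `|0⟩`, Alice applies a quantum
operation to `A A'` and sends `A'` to Bob, who then applies a quantum operation to `B A'`. -/
def oneWayProbs (G : RankOneGame A B C) : Set ℝ :=
  {p | ∃ (k : ℕ)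
      (T : Matrix (A × Fin (k + 1)) (A × Fin (k + 1)) ℂ →ₗ[ℂ]
        Matrix (A × Fin (k + 1)) (A × Fin (k + 1)) ℂ)
      (S : Matrix (B × Fin (k + 1)) (B × Fin (k + 1)) ℂ →ₗ[ℂ]
        Matrix (B × Fin (k + 1)) (B × Fin (k + 1)) ℂ),
      IsQuantumOperation T ∧ IsQuantumOperation S ∧
      p = G.acceptProb
        (onRegister (splitBobOneWay A B C (Fin (k + 1))) S
          (onRegister (splitAliceOneWay A B C (Fin (k + 1))) T
            (ketBra (tensorVec G.ψ (EuclideanSpace.single 0 1)))))}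

/-- The entangled value with one-way communication from Alice to Bob, `ω_qow(G)`. -/
def oneWayValue (G : RankOneGame A B C) : ℝ := sSup G.oneWayProbs

/-- The set of winning probabilities of a single player who has access to both registers `A` and
`B` and to an auxiliary register `E` in a state `η` of his choice. -/
def jointProbs (G : RankOneGame A B C) : Set ℝ :=
  {p | ∃ (k : ℕ) (η : EuclideanSpace ℂ (Fin k))
      (T : Matrix (A × B × Fin k) (A × B × Fin k) ℂ →ₗ[ℂ]
        Matrix (A × B × Fin k) (A × B × Fin k) ℂ),
      ‖η‖ = 1 ∧ IsQuantumOperation T ∧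
      p = G.acceptProb (onRegister (splitJoint A B C (Fin k)) T (ketBra (tensorVec G.ψ η)))}

/-- The maximal value `V(G)`. -/
def maximalValue (G : RankOneGame A B C) : ℝ := sSup G.jointProbs

end RankOneGame

/-- `n^{-1/2} ∑ᵢ |f i⟩`. -/
def uniformState {ι : Type*} [DecidableEq ι] (n : ℕ) (f : Fin n → ι) : EuclideanSpace ℂ ι :=
  ((1 / Real.sqrt n : ℝ) : ℂ) • ∑ i, EuclideanSpace.single (f i) (1 : ℂ)

theorem norm_uniformState {ι : Type*} [Fintype ι] [DecidableEq ι] (n : ℕ) [NeZero n]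
    (f : Fin n → ι) (hf : Function.Injective f) : ‖uniformState n f‖ = 1 := by
  have hn : (0 : ℝ) < n := by exact_mod_cast Nat.pos_of_ne_zero (NeZero.ne n)
  have h : ‖∑ i, EuclideanSpace.single (f i) (1 : ℂ)‖ ^ 2 = (n : ℝ) := by
    have ho : Orthonormal ℂ (fun i => EuclideanSpace.single (f i) (1 : ℂ)) :=
      (EuclideanSpace.orthonormal_single (𝕜 := ℂ) (ι := ι)).comp f hf
    have h2 := ho.inner_sum (fun _ => 1) (fun _ => 1) Finset.univ
    simp only [one_smul, map_one, mul_one, Finset.sum_const, Finset.card_univ, Fintype.card_fin,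
      nsmul_eq_mul] at h2
    rw [inner_self_eq_norm_sq_to_K] at h2
    exact Complex.ofReal_injective (by simpa using h2)
  have h' : ‖∑ i, EuclideanSpace.single (f i) (1 : ℂ)‖ = Real.sqrt n := by
    rw [← h, Real.sqrt_sq (norm_nonneg _)]
  rw [uniformState, norm_smul, h', Complex.norm_real, Real.norm_of_nonneg (by positivity)]
  exact one_div_mul_cancel (Real.sqrt_pos.mpr hn).ne'

/-- The game `G_C`, with `ψ = n^{-1/2} ∑ᵢ |i1⟩|i⟩` and `γ = n^{-1/2} ∑ᵢ |1i⟩|i⟩`; the basis vector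
`|1⟩` has index `0 : Fin n`. -/
def gameC (n : ℕ) [NeZero n] : RankOneGame (Fin n) (Fin n) (Fin n) where
  ψ := uniformState n fun i => (i, 0, i)
  γ := uniformState n fun i => (0, i, i)
  norm_ψ := norm_uniformState n _ fun _ _ h => congrArg Prod.fst h
  norm_γ := norm_uniformState n _ fun _ _ h => congrArg (fun x => x.2.1) h

/-- The game `G_R`, with `ψ = n^{-1/2} ∑ᵢ |1i⟩|i⟩` and `γ = n^{-1/2} ∑ᵢ |i1⟩|i⟩`. -/
def gameR (n : ℕ) [NeZero n] : RankOneGame (Fin n) (Fin n) (Fin n) where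
  ψ := uniformState n fun i => (0, i, i)
  γ := uniformState n fun i => (i, 0, i)
  norm_ψ := norm_uniformState n _ fun _ _ h => congrArg (fun x => x.2.1) h
  norm_γ := norm_uniformState n _ fun _ _ h => congrArg Prod.fst h

end QuantumGame

end

/-
Replacing a register `R` of a composite system by an independent maximally mixed one loses at most a
factor `|R|²` in every probability: `X ≤ |R|² (1/|R|) ⊗ tr_R X` for positive semidefinite `X`. Once
Alice's question is replaced in this way, her answer and her message no longer depend on `ψ`, so the
players can share them in advance, whence `ω_qow ≤ |A|² ω*`. Once Bob's question is replaced, Alice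
can prepare it herself, perform the joint operation and send Bob his answer, whence
`V ≤ |B|² ω_qow`.

For `G_C` and `G_R`, a swap of registers wins with certainty in the larger class of strategies. In
the smaller class, one player has to become maximally entangled with the referee's register `C`,
starting from a question that is uncorrelated with `C`. By no signalling, the other player's
operation does not affect the state of this player and `C`, which is therefore a product `β ⊗ 1/n`
and overlaps with the maximally entangled vector with probability `1/n²`.
-/

noncomputable section

namespace QuantumGame

theorem kronecker_submatrix_prodComm {ι κ : Type*} (X : Matrix ι ι ℂ) (Y : Matrix κ κ ℂ) :
    (X ⊗ₖ Y).submatrix (Equiv.prodComm κ ι) (Equiv.prodComm κ ι) = Y ⊗ₖ X := by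
  ext x y
  exact mul_comm _ _

section Registers

variable {R E S : Type*}

theorem onRegister_apply (e : S ≃ R × E) (T : Matrix R R ℂ →ₗ[ℂ] Matrix R R ℂ)
    (X : Matrix S S ℂ) (s t : S) :
    onRegister e T X s t =
      T (Matrix.of fun i j => X (e.symm (i, (e s).2)) (e.symm (j, (e t).2))) (e s).1 (e t).1 :=
  rfl

/-- The linear map `T ⊗ id_E` on the matrices of `S`, that is, `onRegister e T` as a linear map,
so that it can be composed and again applied to a register of a larger system. -/
def registerMap (e : S ≃ R × E) (T : Matrix R R ℂ →ₗ[ℂ] Matrix R R ℂ) :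
    Matrix S S ℂ →ₗ[ℂ] Matrix S S ℂ where
  toFun := onRegister e T
  map_add' X Y := by
    ext s t
    exact congrFun₂ (T.map_add (Matrix.of fun i j => X (e.symm (i, (e s).2)) (e.symm (j, (e t).2)))
      (Matrix.of fun i j => Y (e.symm (i, (e s).2)) (e.symm (j, (e t).2)))) _ _
  map_smul' c X := by
    ext s t
    exact congrFun₂ (T.map_smul c
      (Matrix.of fun i j => X (e.symm (i, (e s).2)) (e.symm (j, (e t).2)))) _ _

theorem registerMap_apply (e : S ≃ R × E) (T : Matrix R R ℂ →ₗ[ℂ] Matrix R R ℂ)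
    (X : Matrix S S ℂ) : registerMap e T X = onRegister e T X :=
  rfl

theorem onRegister_comp (e : S ≃ R × E) (T U : Matrix R R ℂ →ₗ[ℂ] Matrix R R ℂ)
    (X : Matrix S S ℂ) : onRegister e (T ∘ₗ U) X = onRegister e T (onRegister e U X) := by
  ext s t
  simp only [onRegister_apply, LinearMap.comp_apply, Equiv.apply_symm_apply]
  rfl

theorem onRegister_submatrix {S' E' : Type*} {e : S ≃ R × E} {e' : S' ≃ R × E'} {g : S' → S}
    {h : E' → E} (hg : ∀ s, e (g s) = ((e' s).1, h (e' s).2))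
    (T : Matrix R R ℂ →ₗ[ℂ] Matrix R R ℂ) (X : Matrix S S ℂ) :
    (onRegister e T X).submatrix g g = onRegister e' T (X.submatrix g g) := by
  have hg' (i : R) (u : E') : e.symm (i, h u) = g (e'.symm (i, u)) := by
    rw [Equiv.symm_apply_eq, hg, Equiv.apply_symm_apply]
  ext s t
  simp only [Matrix.submatrix_apply, onRegister_apply, hg, hg']

theorem onRegister_kronecker (e : S ≃ R × E) (T : Matrix R R ℂ →ₗ[ℂ] Matrix R R ℂ)
    (X : Matrix R R ℂ) (Y : Matrix E E ℂ) :
    onRegister e T ((X ⊗ₖ Y).submatrix e e) = (T X ⊗ₖ Y).submatrix e e := by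
  ext s t
  have hblock : (Matrix.of fun i j => ((X ⊗ₖ Y).submatrix e e) (e.symm (i, (e s).2))
      (e.symm (j, (e t).2))) = Y (e s).2 (e t).2 • X := by
    ext i j
    simp [mul_comm]
  rw [onRegister_apply, hblock, map_smul]
  exact mul_comm _ _

theorem onRegister_registerMap {R' E' : Type*} (e : S ≃ R × E) (e' : R ≃ R' × E')
    (T : Matrix R' R' ℂ →ₗ[ℂ] Matrix R' R' ℂ) (X : Matrix S S ℂ) :
    onRegister e (registerMap e' T) X =
      onRegister ((e.trans (e'.prodCongr (Equiv.refl E))).trans (Equiv.prodAssoc R' E' E)) T X :=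
  rfl

/-- The linear map `T` transported along a reindexing `f` of the basis of its register. It is the
case of `registerMap` in which there is no remaining register. -/
def reindexMap {R' : Type*} (f : R' ≃ R) (T : Matrix R R ℂ →ₗ[ℂ] Matrix R R ℂ) :
    Matrix R' R' ℂ →ₗ[ℂ] Matrix R' R' ℂ :=
  registerMap (f.trans (Equiv.prodUnique R Unit).symm) T

theorem onRegister_submatrix_reindexMap {R' S' E' : Type*} {e : S ≃ R × E} {e' : S' ≃ R' × E'}
    {f : R' ≃ R} {g : S' → S} {h : E' → E} (hg : ∀ s, e (g s) = (f (e' s).1, h (e' s).2))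
    (T : Matrix R R ℂ →ₗ[ℂ] Matrix R R ℂ) (X : Matrix S S ℂ) :
    (onRegister e T X).submatrix g g = onRegister e' (reindexMap f T) (X.submatrix g g) := by
  rw [reindexMap, onRegister_registerMap]
  exact onRegister_submatrix (h := fun u => h u.2) hg T X

variable [Fintype R]

/-- The partial trace `tr_R` of a matrix of the composite system `S`, which `e` displays as the
register `R` together with the remaining registers `E`. -/
def partialTrace (e : S ≃ R × E) (X : Matrix S S ℂ) : Matrix E E ℂ :=
  ∑ r, X.submatrix (fun u => e.symm (r, u)) fun u => e.symm (r, u)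

theorem partialTrace_apply (e : S ≃ R × E) (X : Matrix S S ℂ) (u v : E) :
    partialTrace e X u v = ∑ r, X (e.symm (r, u)) (e.symm (r, v)) := by
  simp [partialTrace, Matrix.sum_apply]

theorem posSemidef_partialTrace (e : S ≃ R × E) {X : Matrix S S ℂ} (hX : X.PosSemidef) :
    (partialTrace e X).PosSemidef :=
  Matrix.posSemidef_sum _ fun _ _ => hX.submatrix _

theorem trace_partialTrace [Fintype E] [Fintype S] (e : S ≃ R × E) (X : Matrix S S ℂ) :
    (partialTrace e X).trace = X.trace := by
  simp only [Matrix.trace, Matrix.diag, partialTrace_apply]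
  rw [← e.symm.sum_comp fun s => X s s, Fintype.sum_prod_type_right]

theorem trace_kronecker_one_mul [DecidableEq R] [Fintype E] [Fintype S] (e : S ≃ R × E)
    (M : Matrix E E ℂ) (X : Matrix S S ℂ) :
    (((1 : Matrix R R ℂ) ⊗ₖ M).submatrix e e * X).trace = (M * partialTrace e X).trace := by
  simp only [Matrix.trace, Matrix.diag, Matrix.mul_apply, partialTrace_apply, Finset.mul_sum]
  refine (e.symm.sum_comp _).symm.trans ((Fintype.sum_prod_type_right _).trans ?_)
  refine Finset.sum_congr rfl fun u _ => ?_
  refine (Finset.sum_congr rfl fun r _ => ?_).trans Finset.sum_comm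
  refine (e.symm.sum_comp _).symm.trans ((Fintype.sum_prod_type_right _).trans ?_)
  simp [Matrix.one_apply]

theorem partialTrace_partialTrace {F S' P Q : Type*} [Fintype F] [Fintype Q]
    {d : S ≃ F × S'} {e : S' ≃ R × P} {q : S ≃ Q × P} (g : F × R ≃ Q)
    (h : ∀ f r x, d.symm (f, e.symm (r, x)) = q.symm (g (f, r), x)) (X : Matrix S S ℂ) :
    partialTrace e (partialTrace d X) = partialTrace q X := by
  ext x y
  simp only [partialTrace_apply, h]
  rw [← g.sum_comp, Fintype.sum_prod_type_right]

theorem partialTrace_submatrix {S' : Type*} (e : S ≃ R × E) (σ : S' ≃ S) (X : Matrix S S ℂ) :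
    partialTrace (σ.trans e) (X.submatrix σ σ) = partialTrace e X := by
  ext u v
  simp [partialTrace_apply]

end Registers

theorem partialTrace_onRegister_of_disjoint {R E S F S' E' : Type*} [Fintype F] {d : S ≃ F × S'}
    {e : S ≃ R × E} {e' : S' ≃ R × E'} {h : F → E' → E}
    (hd : ∀ f s, e (d.symm (f, s)) = ((e' s).1, h f (e' s).2))
    (T : Matrix R R ℂ →ₗ[ℂ] Matrix R R ℂ) (X : Matrix S S ℂ) :
    partialTrace d (onRegister e T X) = onRegister e' T (partialTrace d X) := by
  rw [← registerMap_apply e', partialTrace, partialTrace, map_sum]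
  exact Finset.sum_congr rfl fun f _ => onRegister_submatrix (hd f) T X

section Operations

variable {R E S : Type*} [Fintype R] {T U : Matrix R R ℂ →ₗ[ℂ] Matrix R R ℂ}

namespace IsQuantumOperation

theorem partialTrace_onRegister (hT : IsQuantumOperation T) (e : S ≃ R × E) (X : Matrix S S ℂ) :
    partialTrace e (onRegister e T X) = partialTrace e X := by
  ext u v
  have h := hT.tracePreserving (Matrix.of fun i j => X (e.symm (i, u)) (e.symm (j, v)))
  simpa [partialTrace_apply, onRegister_apply, Matrix.trace] using h

theorem trace_onRegister [Finite E] [Fintype S] (hT : IsQuantumOperation T) (e : S ≃ R × E)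
    (X : Matrix S S ℂ) : (onRegister e T X).trace = X.trace := by
  have := Fintype.ofFinite E
  rw [← trace_partialTrace e, hT.partialTrace_onRegister, trace_partialTrace]

theorem posSemidef_onRegister [Finite E] (hT : IsQuantumOperation T) (e : S ≃ R × E)
    {X : Matrix S S ℂ} (hX : X.PosSemidef) : (onRegister e T X).PosSemidef := by
  obtain ⟨k, ⟨f⟩⟩ := Finite.exists_equiv_fin E
  have h := (hT.completelyPositive k _
    (hX.submatrix fun y : R × Fin k => e.symm (y.1, f.symm y.2))).submatrix
      fun s => ((e s).1, f (e s).2)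
  convert h using 1
  ext s t
  simp [onRegister_apply]

theorem comp (hT : IsQuantumOperation T) (hU : IsQuantumOperation U) :
    IsQuantumOperation (T ∘ₗ U) where
  completelyPositive k X hX := by
    rw [onRegister_comp]
    exact hT.completelyPositive k _ (hU.completelyPositive k X hX)
  tracePreserving X := by
    rw [LinearMap.comp_apply, hT.tracePreserving, hU.tracePreserving]

theorem registerMap [Finite E] [Fintype S] (hT : IsQuantumOperation T) (e : S ≃ R × E) :
    IsQuantumOperation (registerMap e T) where
  completelyPositive k X hX := by
    rw [onRegister_registerMap]
    exact hT.posSemidef_onRegister _ hX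
  tracePreserving := hT.trace_onRegister e

theorem reindexMap {R' : Type*} [Fintype R'] (hT : IsQuantumOperation T) (f : R' ≃ R) :
    IsQuantumOperation (reindexMap f T) :=
  hT.registerMap _

end IsQuantumOperation

theorem isQuantumOperation_reindexLinearEquiv (σ : R ≃ R) :
    IsQuantumOperation (Matrix.reindexLinearEquiv ℂ ℂ σ σ).toLinearMap where
  completelyPositive _ _ hX := hX.submatrix (Prod.map σ.symm id)
  tracePreserving X := σ.symm.sum_comp fun r => X r r

end Operations

section States

variable {ι κ : Type*}

theorem ketBra_apply (v : EuclideanSpace ℂ ι) (x y : ι) : ketBra v x y = v x * star (v y) :=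
  rfl

theorem ketBra_smul (c : ℂ) (v : EuclideanSpace ℂ ι) :
    ketBra (c • v) = (c * star c) • ketBra v := by
  ext x y
  simp [ketBra_apply, mul_mul_mul_comm]

theorem tensorVec_apply (v : EuclideanSpace ℂ ι) (w : EuclideanSpace ℂ κ) (x : ι × κ) :
    tensorVec v w x = v x.1 * w x.2 :=
  rfl

theorem ketBra_tensorVec (v : EuclideanSpace ℂ ι) (w : EuclideanSpace ℂ κ) :
    ketBra (tensorVec v w) = ketBra v ⊗ₖ ketBra w := by
  ext x y
  simp [ketBra_apply, tensorVec_apply, mul_mul_mul_comm]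

theorem posSemidef_ketBra [Finite ι] (v : EuclideanSpace ℂ ι) : (ketBra v).PosSemidef :=
  Matrix.posSemidef_vecMulVec_self_star v.ofLp

variable [Fintype ι] [Fintype κ]

theorem trace_ketBra (v : EuclideanSpace ℂ ι) : (ketBra v).trace = (‖v‖ : ℂ) ^ 2 := by
  simp [Matrix.trace, ketBra_apply, ← Complex.ofReal_pow, EuclideanSpace.norm_sq_eq,
    Complex.mul_conj, Complex.normSq_eq_norm_sq]

theorem ketBra_mul_self {v : EuclideanSpace ℂ ι} (hv : ‖v‖ = 1) :
    ketBra v * ketBra v = ketBra v := by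
  have h : star v.ofLp ⬝ᵥ v.ofLp = 1 := by
    rw [dotProduct_comm, ← EuclideanSpace.inner_eq_star_dotProduct, inner_self_eq_norm_sq_to_K, hv]
    simp
  change Matrix.vecMulVec v.ofLp (star v.ofLp) * Matrix.vecMulVec v.ofLp (star v.ofLp) =
    Matrix.vecMulVec v.ofLp (star v.ofLp)
  rw [Matrix.vecMulVec_mul_vecMulVec, h, one_smul]

theorem posSemidef_norm_sq_smul_one_sub_ketBra [DecidableEq ι] (v : EuclideanSpace ℂ ι) :
    (((‖v‖ : ℂ) ^ 2) • (1 : Matrix ι ι ℂ) - ketBra v).PosSemidef := by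
  refine Matrix.PosSemidef.of_dotProduct_mulVec_nonneg ?_ fun x => ?_
  · refine Matrix.IsHermitian.sub ?_ (posSemidef_ketBra v).isHermitian
    simp [Matrix.IsHermitian, Matrix.conjTranspose_smul]
  · have h : star x ⬝ᵥ ((‖v‖ : ℂ) ^ 2 • 1 - ketBra v).mulVec x =
        (((‖v‖ * ‖WithLp.toLp 2 x‖) ^ 2 - ‖inner ℂ v (WithLp.toLp 2 x)‖ ^ 2 : ℝ) : ℂ) := by
      have hv : ketBra v = Matrix.vecMulVec v.ofLp (star v.ofLp) := rfl
      have hinner : (‖inner ℂ v (WithLp.toLp 2 x)‖ : ℂ) ^ 2 =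
          (x ⬝ᵥ star v.ofLp) * (v.ofLp ⬝ᵥ star x) := by
        rw [← Complex.mul_conj', inner_conj_symm, EuclideanSpace.inner_eq_star_dotProduct,
          EuclideanSpace.inner_eq_star_dotProduct]
      have hnorm : (‖WithLp.toLp 2 x‖ : ℂ) ^ 2 = x ⬝ᵥ star x := by
        rw [← EuclideanSpace.inner_toLp_toLp, inner_self_eq_norm_sq_to_K]
        rfl
      push_cast
      rw [hinner, mul_pow, hnorm, hv, Matrix.sub_mulVec, Matrix.smul_mulVec, Matrix.one_mulVec,
        Matrix.vecMulVec_mulVec, dotProduct_sub, dotProduct_smul, dotProduct_smul]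
      simp [dotProduct_comm, mul_comm]
    rw [h, Complex.zero_le_real, sub_nonneg]
    gcongr
    exact norm_inner_le_norm _ _

end States

section States

variable {ι κ : Type*} [Fintype ι] [Fintype κ]

/-- Density matrices: the mixed states of the register `ℂ^ι`. -/
structure IsDensity (ρ : Matrix ι ι ℂ) : Prop where
  posSemidef : ρ.PosSemidef
  trace_eq_one : ρ.trace = 1

theorem IsDensity.nonempty {ρ : Matrix ι ι ℂ} (hρ : IsDensity ρ) : Nonempty ι := by
  by_contra h
  have := not_nonempty_iff.mp h
  simpa using hρ.trace_eq_one

theorem isDensity_ketBra {v : EuclideanSpace ℂ ι} (hv : ‖v‖ = 1) : IsDensity (ketBra v) where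
  posSemidef := posSemidef_ketBra v
  trace_eq_one := by simp [trace_ketBra, hv]

theorem IsDensity.kronecker {ρ : Matrix ι ι ℂ} {σ : Matrix κ κ ℂ} (hρ : IsDensity ρ)
    (hσ : IsDensity σ) : IsDensity (ρ ⊗ₖ σ) where
  posSemidef := hρ.posSemidef.kronecker hσ.posSemidef
  trace_eq_one := by rw [Matrix.trace_kronecker, hρ.trace_eq_one, hσ.trace_eq_one, mul_one]

theorem isDensity_ketBra_tensorVec {v : EuclideanSpace ℂ ι} {w : EuclideanSpace ℂ κ}
    (hv : ‖v‖ = 1) (hw : ‖w‖ = 1) : IsDensity (ketBra (tensorVec v w)) := by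
  rw [ketBra_tensorVec]
  exact (isDensity_ketBra hv).kronecker (isDensity_ketBra hw)

theorem IsDensity.submatrix_equiv {ρ : Matrix ι ι ℂ} (hρ : IsDensity ρ) (e : κ ≃ ι) :
    IsDensity (ρ.submatrix e e) where
  posSemidef := hρ.posSemidef.submatrix e
  trace_eq_one := (e.sum_comp fun i => ρ i i).trans hρ.trace_eq_one

theorem IsDensity.partialTrace {E S : Type*} [Fintype E] [Fintype S] {ρ : Matrix S S ℂ}
    (hρ : IsDensity ρ) (e : S ≃ ι × E) : IsDensity (partialTrace e ρ) where
  posSemidef := posSemidef_partialTrace e hρ.posSemidef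
  trace_eq_one := (trace_partialTrace e ρ).trans hρ.trace_eq_one

theorem IsQuantumOperation.isDensity_onRegister {E : Type*} [Finite E]
    {T : Matrix ι ι ℂ →ₗ[ℂ] Matrix ι ι ℂ} (hT : IsQuantumOperation T) (e : κ ≃ ι × E)
    {ρ : Matrix κ κ ℂ} (hρ : IsDensity ρ) : IsDensity (onRegister e T ρ) where
  posSemidef := hT.posSemidef_onRegister e hρ.posSemidef
  trace_eq_one := (hT.trace_onRegister e ρ).trans hρ.trace_eq_one

theorem IsQuantumOperation.posSemidef_map {T : Matrix ι ι ℂ →ₗ[ℂ] Matrix ι ι ℂ}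
    (hT : IsQuantumOperation T) {X : Matrix ι ι ℂ} (hX : X.PosSemidef) : (T X).PosSemidef :=
  hT.posSemidef_onRegister (Equiv.prodUnique ι Unit).symm hX

theorem IsQuantumOperation.isDensity_map {T : Matrix ι ι ℂ →ₗ[ℂ] Matrix ι ι ℂ}
    (hT : IsQuantumOperation T) {ρ : Matrix ι ι ℂ} (hρ : IsDensity ρ) : IsDensity (T ρ) where
  posSemidef := hT.posSemidef_map hρ.posSemidef
  trace_eq_one := (hT.tracePreserving ρ).trans hρ.trace_eq_one

/-- The maximally mixed state `1 / |ι|` of the register `ℂ^ι`. -/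
def maximallyMixed (ι : Type*) [Fintype ι] [DecidableEq ι] : Matrix ι ι ℂ :=
  (Fintype.card ι : ℂ)⁻¹ • 1

theorem isDensity_maximallyMixed [DecidableEq ι] [Nonempty ι] :
    IsDensity (maximallyMixed ι) where
  posSemidef := Matrix.PosSemidef.one.smul (by positivity)
  trace_eq_one := by simp [maximallyMixed]

theorem IsDensity.re_map_le {ρ : Matrix ι ι ℂ} (hρ : IsDensity ρ) (f : Matrix ι ι ℂ →ₗ[ℂ] ℂ)
    {c : ℝ} (hf : ∀ v : EuclideanSpace ℂ ι, ‖v‖ = 1 → (f (ketBra v)).re ≤ c) :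
    (f ρ).re ≤ c := by
  have hf' (v : EuclideanSpace ℂ ι) : (f (ketBra v)).re ≤ ‖v‖ ^ 2 * c := by
    rcases eq_or_ne v 0 with rfl | hv
    · have h0 : ketBra (0 : EuclideanSpace ℂ ι) = 0 := by
        ext x y
        simp [ketBra_apply]
      simp [h0]
    · have hv' : (‖v‖ : ℂ) • ((‖v‖ : ℂ)⁻¹ • v) = v :=
        smul_inv_smul₀ (by simpa using hv) v
      have hu : ‖(‖v‖ : ℂ)⁻¹ • v‖ = 1 := norm_smul_inv_norm hv
      rw [← hv', ketBra_smul, hv', map_smul, Complex.star_def, Complex.conj_ofReal, ← sq,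
        ← Complex.ofReal_pow, smul_eq_mul, Complex.re_ofReal_mul]
      exact mul_le_mul_of_nonneg_left (hf _ hu) (sq_nonneg _)
  obtain ⟨m, v, hv⟩ := Matrix.posSemidef_iff_eq_sum_vecMulVec.mp hρ.posSemidef
  have hsum : ρ = ∑ i, ketBra (WithLp.toLp 2 (v i)) := hv
  have hone : ∑ i, ‖WithLp.toLp 2 (v i)‖ ^ 2 = 1 := by
    have h := hρ.trace_eq_one
    rw [hsum, Matrix.trace_sum] at h
    simp only [trace_ketBra] at h
    exact_mod_cast h
  calc (f ρ).re = ∑ i, (f (ketBra (WithLp.toLp 2 (v i)))).re := by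
        rw [hsum, map_sum, Complex.re_sum]
    _ ≤ ∑ i, ‖WithLp.toLp 2 (v i)‖ ^ 2 * c := Finset.sum_le_sum fun i _ => hf' _
    _ = c := by rw [← Finset.sum_mul, hone, one_mul]

/-- The map that discards its input and prepares the state `ρ`. -/
def prepareMap (ρ : Matrix ι ι ℂ) : Matrix ι ι ℂ →ₗ[ℂ] Matrix ι ι ℂ :=
  (Matrix.traceLinearMap ι ℂ ℂ).smulRight ρ

theorem prepareMap_apply (ρ X : Matrix ι ι ℂ) : prepareMap ρ X = X.trace • ρ :=
  rfl

theorem onRegister_refl_prepareMap {E : Type*} (ρ : Matrix ι ι ℂ)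
    (X : Matrix (ι × E) (ι × E) ℂ) :
    onRegister (Equiv.refl (ι × E)) (prepareMap ρ) X =
      ρ ⊗ₖ partialTrace (Equiv.refl (ι × E)) X := by
  ext s t
  simp [onRegister_apply, prepareMap_apply, partialTrace_apply, Matrix.trace, mul_comm]

theorem IsDensity.isQuantumOperation_prepareMap {ρ : Matrix ι ι ℂ} (hρ : IsDensity ρ) :
    IsQuantumOperation (prepareMap ρ) where
  completelyPositive k X hX := by
    rw [onRegister_refl_prepareMap]
    exact hρ.posSemidef.kronecker (posSemidef_partialTrace _ hX)
  tracePreserving X := by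
    rw [prepareMap_apply, Matrix.trace_smul, hρ.trace_eq_one, smul_eq_mul, mul_one]

end States

section Decoupling

open scoped Matrix

variable {R E S : Type*} [Fintype R] [DecidableEq R]

theorem posSemidef_card_smul_one_sub_ones :
    ((Fintype.card R : ℂ) • (1 : Matrix R R ℂ) - Matrix.of fun _ _ => 1).PosSemidef := by
  let u : EuclideanSpace ℂ R := WithLp.toLp 2 fun _ => 1
  have hnorm : (‖u‖ : ℂ) ^ 2 = Fintype.card R := by
    simp [u, ← Complex.ofReal_pow, EuclideanSpace.norm_sq_eq]
  have hones : ketBra u = Matrix.of fun _ _ => 1 := by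
    ext x y
    simp [ketBra_apply, u]
  rw [← hnorm, ← hones]
  exact posSemidef_norm_sq_smul_one_sub_ketBra u

theorem posSemidef_one_sub_ketBra {v : EuclideanSpace ℂ R} (hv : ‖v‖ = 1) :
    (1 - ketBra v).PosSemidef := by
  simpa [hv] using posSemidef_norm_sq_smul_one_sub_ketBra v

/-- The state of the system `S` after its register `R` has been replaced by a maximally mixed
register that is independent of the remaining registers `E`. -/
def depolarize (e : S ≃ R × E) (X : Matrix S S ℂ) : Matrix S S ℂ :=
  (maximallyMixed R ⊗ₖ partialTrace e X).submatrix e e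

theorem posSemidef_card_sq_smul_depolarize_sub (e : S ≃ R × E) {X : Matrix S S ℂ}
    (hX : X.PosSemidef) :
    ((Fintype.card R : ℂ) ^ 2 • depolarize e X - X).PosSemidef := by
  let p (s : S) : R := (e s).1
  let q (r : R) (s : S) : S := e.symm (r, (e s).2)
  -- The first summand of `hsum` is the pinching inequality `X ≤ |R| ∑ᵣ Pᵣ X Pᵣ`; the second one
  -- adds, for every `r`, the copies of the diagonal block of `r` at the other basis vectors.
  have hdiag : (((Fintype.card R : ℂ) • (1 : Matrix R R ℂ) - Matrix.of fun _ _ => 1).submatrix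
      p p ⊙ X).PosSemidef :=
    (posSemidef_card_smul_one_sub_ones.submatrix p).hadamard hX
  have hblock (r : R) : ((1 - ketBra (EuclideanSpace.single r 1)).submatrix p p ⊙
      X.submatrix (q r) (q r)).PosSemidef :=
    ((posSemidef_one_sub_ketBra (by simp)).submatrix p).hadamard (hX.submatrix (q r))
  have hsum : (Fintype.card R : ℂ) ^ 2 • depolarize e X - X =
      ((Fintype.card R : ℂ) • (1 : Matrix R R ℂ) - Matrix.of fun _ _ => 1).submatrix p p ⊙ X +
        (Fintype.card R : ℂ) • ∑ r, (1 - ketBra (EuclideanSpace.single r 1)).submatrix p p ⊙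
          X.submatrix (q r) (q r) := by
    ext s t
    have : Nonempty R := ⟨(e s).1⟩
    by_cases h : (e s).1 = (e t).1
    · have hs : e.symm ((e t).1, (e s).2) = s := by rw [← h, Prod.mk.eta, Equiv.symm_apply_apply]
      simp only [depolarize, maximallyMixed, Matrix.sub_apply, Matrix.smul_apply,
        Matrix.submatrix_apply, Matrix.kroneckerMap_apply, h, Matrix.one_apply_eq, smul_eq_mul,
        mul_one, partialTrace_apply, Matrix.add_apply, Matrix.hadamard_apply, Matrix.of_apply,
        sub_mul, one_mul, Matrix.sum_apply, ketBra_apply, PiLp.single_apply, RCLike.star_def,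
        MonoidWithZeroHom.map_ite_one_zero, mul_ite, mul_zero, ite_mul, zero_mul,
        Finset.sum_sub_distrib, Finset.sum_ite_eq, Finset.mem_univ, ↓reduceIte, hs, Prod.mk.eta,
        Equiv.symm_apply_apply, p, q]
      field_simp
      ring
    · simp [depolarize, maximallyMixed, Matrix.sum_apply, h, ketBra_apply, partialTrace_apply, p,
        q]
  rw [hsum]
  exact hdiag.add ((Matrix.posSemidef_sum _ fun r _ => hblock r).smul (Nat.cast_nonneg _))

theorem re_map_le_card_sq_mul_re_map_depolarize (e : S ≃ R × E)
    (f : Matrix S S ℂ →ₗ[ℂ] ℂ) (hf : ∀ X : Matrix S S ℂ, X.PosSemidef → 0 ≤ (f X).re)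
    {X : Matrix S S ℂ} (hX : X.PosSemidef) :
    (f X).re ≤ (Fintype.card R : ℝ) ^ 2 * (f (depolarize e X)).re := by
  have h := hf _ (posSemidef_card_sq_smul_depolarize_sub e hX)
  rwa [map_sub, map_smul, Complex.sub_re, sub_nonneg, smul_eq_mul, ← Complex.ofReal_natCast,
    ← Complex.ofReal_pow, Complex.re_ofReal_mul] at h

end Decoupling

theorem re_trace_mul_nonneg {ι : Type*} [Fintype ι] {X Y : Matrix ι ι ℂ} (hX : X.PosSemidef)
    (hY : Y.PosSemidef) : 0 ≤ (X * Y).trace.re := by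
  classical
  open scoped MatrixOrder in
  obtain ⟨M, hM⟩ := CStarAlgebra.nonneg_iff_eq_star_mul_self.mp hX.nonneg
  rw [hM, Matrix.mul_assoc, Matrix.trace_mul_comm]
  exact (Complex.nonneg_iff.mp (hY.mul_mul_conjTranspose_same M).trace_nonneg).1

namespace RankOneGame

variable {A B C : Type*} [Fintype A] [Fintype B] [Fintype C] (G : RankOneGame A B C)

section Acceptance

variable {E : Type*} [Fintype E] [DecidableEq E]

/-- The linear functional `ρ ↦ tr((|γ⟩⟨γ| ⊗ 1_E) ρ)`, whose real part is the acceptance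
probability. -/
def acceptMap (E : Type*) [Fintype E] [DecidableEq E] :
    Matrix ((A × B × C) × E) ((A × B × C) × E) ℂ →ₗ[ℂ] ℂ :=
  Matrix.traceLinearMap _ ℂ ℂ ∘ₗ LinearMap.mulLeft ℂ (ketBra G.γ ⊗ₖ (1 : Matrix E E ℂ))

theorem acceptProb_eq_trace_partialTrace (ρ : Matrix ((A × B × C) × E) ((A × B × C) × E) ℂ) :
    G.acceptProb ρ = (ketBra G.γ * partialTrace (Equiv.prodComm _ _) ρ).trace.re := by
  rw [← trace_kronecker_one_mul, kronecker_submatrix_prodComm, acceptProb]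

theorem acceptProb_nonneg {ρ : Matrix ((A × B × C) × E) ((A × B × C) × E) ℂ}
    (hρ : ρ.PosSemidef) : 0 ≤ G.acceptProb ρ :=
  re_trace_mul_nonneg ((posSemidef_ketBra G.γ).kronecker .one) hρ

theorem acceptProb_le_one {ρ : Matrix ((A × B × C) × E) ((A × B × C) × E) ℂ}
    (hρ : IsDensity ρ) : G.acceptProb ρ ≤ 1 := by
  classical
  have h := re_trace_mul_nonneg (posSemidef_one_sub_ketBra G.norm_γ)
    (posSemidef_partialTrace (Equiv.prodComm _ _) hρ.posSemidef)
  rw [sub_mul, one_mul, Matrix.trace_sub, trace_partialTrace, hρ.trace_eq_one, Complex.sub_re,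
    Complex.one_re, sub_nonneg] at h
  rwa [acceptProb_eq_trace_partialTrace]

theorem acceptProb_mem_Icc {ρ : Matrix ((A × B × C) × E) ((A × B × C) × E) ℂ}
    (hρ : IsDensity ρ) : G.acceptProb ρ ∈ Set.Icc 0 1 :=
  ⟨G.acceptProb_nonneg hρ.posSemidef, G.acceptProb_le_one hρ⟩

theorem acceptProb_partialTrace {F E' : Type*} [Fintype F] [Fintype E'] [DecidableEq E']
    {d : (A × B × C) × E' ≃ F × ((A × B × C) × E)} (g : F × E ≃ E')
    (hd : ∀ f x u, d.symm (f, (x, u)) = (x, g (f, u)))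
    (ρ : Matrix ((A × B × C) × E') ((A × B × C) × E') ℂ) :
    G.acceptProb (partialTrace d ρ) = G.acceptProb ρ := by
  rw [acceptProb_eq_trace_partialTrace, acceptProb_eq_trace_partialTrace,
    partialTrace_partialTrace (q := Equiv.prodComm _ _) g fun f u x => hd f x u]

theorem acceptProb_submatrix {E' : Type*} [Fintype E'] [DecidableEq E'] (g : E' ≃ E)
    (ρ : Matrix ((A × B × C) × E) ((A × B × C) × E) ℂ) :
    G.acceptProb (ρ.submatrix (Prod.map id g) (Prod.map id g)) = G.acceptProb ρ := by
  rw [acceptProb_eq_trace_partialTrace, acceptProb_eq_trace_partialTrace]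
  congr 3
  ext x y
  simp only [partialTrace_apply]
  exact g.sum_comp fun u => ρ (x, u) (y, u)

theorem acceptProb_ketBra_γ {η : EuclideanSpace ℂ E} (hη : ‖η‖ = 1) :
    G.acceptProb (ketBra (tensorVec G.γ η)) = 1 := by
  rw [acceptProb, ketBra_tensorVec, ← Matrix.mul_kronecker_mul, ketBra_mul_self G.norm_γ,
    Matrix.one_mul, Matrix.trace_kronecker, trace_ketBra, trace_ketBra, G.norm_γ, hη]
  simp

theorem acceptProb_le_of_γ_eq {R P : Type*} [Fintype R] [Fintype P] (e : A × B × C ≃ R × P)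
    {α : EuclideanSpace ℂ R} {w : EuclideanSpace ℂ P} (hα : ‖α‖ = 1)
    (hγ : ∀ x, G.γ x = tensorVec α w (e x))
    {ρ : Matrix ((A × B × C) × E) ((A × B × C) × E) ℂ} (hρ : ρ.PosSemidef) :
    G.acceptProb ρ ≤
      (ketBra w * partialTrace e (partialTrace (Equiv.prodComm _ _) ρ)).trace.re := by
  classical
  have hketBra : ketBra G.γ = (ketBra α ⊗ₖ ketBra w).submatrix e e := by
    rw [← ketBra_tensorVec]
    ext x y
    simp [ketBra_apply, hγ]
  have hsub : ((1 - ketBra α) ⊗ₖ ketBra w).submatrix e e =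
      (1 ⊗ₖ ketBra w).submatrix e e - ketBra G.γ := by
    rw [hketBra]
    ext x y
    exact sub_mul _ _ _
  have h := re_trace_mul_nonneg
    (((posSemidef_one_sub_ketBra hα).kronecker (posSemidef_ketBra w)).submatrix e)
    (posSemidef_partialTrace (Equiv.prodComm _ _) hρ)
  rwa [hsub, sub_mul, Matrix.trace_sub, Complex.sub_re, sub_nonneg, trace_kronecker_one_mul,
    ← acceptProb_eq_trace_partialTrace] at h

end Acceptance

section Values

theorem nonempty_registers (G : RankOneGame A B C) : Nonempty (A × B × C) :=
  (isDensity_ketBra G.norm_ψ).nonempty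

theorem nonempty_alice (G : RankOneGame A B C) : Nonempty A :=
  let ⟨a, _, _⟩ := G.nonempty_registers
  ⟨a⟩

theorem nonempty_bob (G : RankOneGame A B C) : Nonempty B :=
  let ⟨_, b, _⟩ := G.nonempty_registers
  ⟨b⟩

theorem entangledProbs_subset_Icc : G.entangledProbs ⊆ Set.Icc 0 1 := by
  rintro p ⟨k, l, φ, T, S, hφ, hT, hS, rfl⟩
  exact G.acceptProb_mem_Icc <| hT.isDensity_onRegister _ <| hS.isDensity_onRegister _ <|
    isDensity_ketBra_tensorVec G.norm_ψ hφ

theorem oneWayProbs_subset_Icc : G.oneWayProbs ⊆ Set.Icc 0 1 := by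
  rintro p ⟨k, T, S, hT, hS, rfl⟩
  exact G.acceptProb_mem_Icc <| hS.isDensity_onRegister _ <| hT.isDensity_onRegister _ <|
    isDensity_ketBra_tensorVec G.norm_ψ (by simp)

theorem jointProbs_subset_Icc : G.jointProbs ⊆ Set.Icc 0 1 := by
  rintro p ⟨k, η, T, hη, hT, rfl⟩
  exact G.acceptProb_mem_Icc <| hT.isDensity_onRegister _ <|
    isDensity_ketBra_tensorVec G.norm_ψ hη

theorem bddAbove_entangledProbs : BddAbove G.entangledProbs :=
  bddAbove_Icc.mono G.entangledProbs_subset_Icc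

theorem bddAbove_oneWayProbs : BddAbove G.oneWayProbs :=
  bddAbove_Icc.mono G.oneWayProbs_subset_Icc

theorem bddAbove_jointProbs : BddAbove G.jointProbs :=
  bddAbove_Icc.mono G.jointProbs_subset_Icc

theorem entangledValue_nonneg : 0 ≤ G.entangledValue :=
  Real.sSup_nonneg fun _ hp => (G.entangledProbs_subset_Icc hp).1

theorem oneWayValue_nonneg : 0 ≤ G.oneWayValue :=
  Real.sSup_nonneg fun _ hp => (G.oneWayProbs_subset_Icc hp).1

theorem oneWayValue_le_one : G.oneWayValue ≤ 1 :=
  Real.sSup_le (fun _ hp => (G.oneWayProbs_subset_Icc hp).2) zero_le_one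

theorem maximalValue_le_one : G.maximalValue ≤ 1 :=
  Real.sSup_le (fun _ hp => (G.jointProbs_subset_Icc hp).2) zero_le_one

theorem acceptProb_le_entangledValue_of_fin {k l : ℕ}
    {T : Matrix (A × Fin k) (A × Fin k) ℂ →ₗ[ℂ] Matrix (A × Fin k) (A × Fin k) ℂ}
    {S : Matrix (B × Fin l) (B × Fin l) ℂ →ₗ[ℂ] Matrix (B × Fin l) (B × Fin l) ℂ}
    (hT : IsQuantumOperation T) (hS : IsQuantumOperation S)
    {ρ : Matrix (Fin k × Fin l) (Fin k × Fin l) ℂ} (hρ : IsDensity ρ) :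
    G.acceptProb (onRegister (splitAliceEnt A B C (Fin k) (Fin l)) T
      (onRegister (splitBobEnt A B C (Fin k) (Fin l)) S (ketBra G.ψ ⊗ₖ ρ))) ≤
      G.entangledValue := by
  let f := G.acceptMap (Fin k × Fin l) ∘ₗ registerMap (splitAliceEnt A B C (Fin k) (Fin l)) T ∘ₗ
    registerMap (splitBobEnt A B C (Fin k) (Fin l)) S ∘ₗ
      Matrix.kroneckerBilinear (R := ℂ) (ketBra G.ψ)
  refine hρ.re_map_le f fun φ hφ =>
    le_csSup G.bddAbove_entangledProbs ⟨k, l, φ, T, S, hφ, hT, hS, ?_⟩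
  rw [ketBra_tensorVec]
  rfl

theorem acceptProb_le_entangledValue {A' B' : Type*} [Fintype A'] [DecidableEq A'] [Fintype B']
    [DecidableEq B'] {T : Matrix (A × A') (A × A') ℂ →ₗ[ℂ] Matrix (A × A') (A × A') ℂ}
    {S : Matrix (B × B') (B × B') ℂ →ₗ[ℂ] Matrix (B × B') (B × B') ℂ}
    (hT : IsQuantumOperation T) (hS : IsQuantumOperation S)
    {ρ : Matrix (A' × B') (A' × B') ℂ} (hρ : IsDensity ρ) :
    G.acceptProb (onRegister (splitAliceEnt A B C A' B') T
      (onRegister (splitBobEnt A B C A' B') S (ketBra G.ψ ⊗ₖ ρ))) ≤ G.entangledValue := by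
  let f := (Fintype.equivFin A').symm
  let g := (Fintype.equivFin B').symm
  let fA := (Equiv.refl A).prodCongr f
  let gB := (Equiv.refl B).prodCongr g
  have hA : (onRegister (splitAliceEnt A B C A' B') T
      (onRegister (splitBobEnt A B C A' B') S (ketBra G.ψ ⊗ₖ ρ))).submatrix
        (Prod.map id (f.prodCongr g)) (Prod.map id (f.prodCongr g)) =
      onRegister (splitAliceEnt A B C _ _) (reindexMap fA T)
        ((onRegister (splitBobEnt A B C A' B') S (ketBra G.ψ ⊗ₖ ρ)).submatrix
          (Prod.map id (f.prodCongr g)) (Prod.map id (f.prodCongr g))) :=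
    onRegister_submatrix_reindexMap (h := fun u => (u.1, u.2.1, g u.2.2)) (fun _ => rfl) T _
  have hB : (onRegister (splitBobEnt A B C A' B') S (ketBra G.ψ ⊗ₖ ρ)).submatrix
        (Prod.map id (f.prodCongr g)) (Prod.map id (f.prodCongr g)) =
      onRegister (splitBobEnt A B C _ _) (reindexMap gB S)
        (ketBra G.ψ ⊗ₖ ρ.submatrix (f.prodCongr g) (f.prodCongr g)) :=
    onRegister_submatrix_reindexMap (h := fun u => (u.1, u.2.1, f u.2.2)) (fun _ => rfl) S _
  have h := G.acceptProb_le_entangledValue_of_fin (hT.reindexMap fA) (hS.reindexMap gB)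
    (hρ.submatrix_equiv (f.prodCongr g))
  rwa [← G.acceptProb_submatrix (f.prodCongr g), hA, hB]

theorem acceptProb_le_oneWayValue_of_fin {k : ℕ}
    {T : Matrix (A × Fin (k + 1)) (A × Fin (k + 1)) ℂ →ₗ[ℂ]
      Matrix (A × Fin (k + 1)) (A × Fin (k + 1)) ℂ}
    {S : Matrix (B × Fin (k + 1)) (B × Fin (k + 1)) ℂ →ₗ[ℂ]
      Matrix (B × Fin (k + 1)) (B × Fin (k + 1)) ℂ}
    (hT : IsQuantumOperation T) (hS : IsQuantumOperation S)
    {ρ : Matrix (Fin (k + 1)) (Fin (k + 1)) ℂ} (hρ : IsDensity ρ) :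
    G.acceptProb (onRegister (splitBobOneWay A B C (Fin (k + 1))) S
      (onRegister (splitAliceOneWay A B C (Fin (k + 1))) T (ketBra G.ψ ⊗ₖ ρ))) ≤
      G.oneWayValue := by
  let P := registerMap (Equiv.prodComm A (Fin (k + 1))) (prepareMap ρ)
  have hP : IsQuantumOperation P := hρ.isQuantumOperation_prepareMap.registerMap _
  have hprepare : onRegister (splitAliceOneWay A B C (Fin (k + 1))) P
      (ketBra (tensorVec G.ψ (EuclideanSpace.single 0 1))) = ketBra G.ψ ⊗ₖ ρ := by
    have htrace : (ketBra (EuclideanSpace.single (0 : Fin (k + 1)) (1 : ℂ))).trace = 1 := by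
      simp [trace_ketBra]
    have h := onRegister_kronecker (Equiv.prodComm (A × B × C) (Fin (k + 1))) (prepareMap ρ)
      (ketBra (EuclideanSpace.single 0 1)) (ketBra G.ψ)
    rw [prepareMap_apply, htrace, one_smul, kronecker_submatrix_prodComm,
      kronecker_submatrix_prodComm, ← ketBra_tensorVec] at h
    exact h
  refine le_csSup G.bddAbove_oneWayProbs ⟨k, T ∘ₗ P, S, hT.comp hP, hS, ?_⟩
  rw [onRegister_comp, hprepare]

theorem acceptProb_le_oneWayValue {A' : Type*} [Fintype A'] [DecidableEq A']
    {T : Matrix (A × A') (A × A') ℂ →ₗ[ℂ] Matrix (A × A') (A × A') ℂ}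
    {S : Matrix (B × A') (B × A') ℂ →ₗ[ℂ] Matrix (B × A') (B × A') ℂ}
    (hT : IsQuantumOperation T) (hS : IsQuantumOperation S) {ρ : Matrix A' A' ℂ}
    (hρ : IsDensity ρ) :
    G.acceptProb (onRegister (splitBobOneWay A B C A') S
      (onRegister (splitAliceOneWay A B C A') T (ketBra G.ψ ⊗ₖ ρ))) ≤ G.oneWayValue := by
  obtain ⟨k, ⟨f⟩⟩ : ∃ k, Nonempty (Fin (k + 1) ≃ A') := by
    have : Nonempty A' := hρ.nonempty
    obtain ⟨k, hk⟩ := Nat.exists_eq_succ_of_ne_zero (Fintype.card_ne_zero (α := A'))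
    exact ⟨k, ⟨(Fintype.equivFinOfCardEq hk).symm⟩⟩
  let fA := (Equiv.refl A).prodCongr f
  let fB := (Equiv.refl B).prodCongr f
  have hB : (onRegister (splitBobOneWay A B C A') S
      (onRegister (splitAliceOneWay A B C A') T (ketBra G.ψ ⊗ₖ ρ))).submatrix
        (Prod.map id f) (Prod.map id f) =
      onRegister (splitBobOneWay A B C _) (reindexMap fB S)
        ((onRegister (splitAliceOneWay A B C A') T (ketBra G.ψ ⊗ₖ ρ)).submatrix
          (Prod.map id f) (Prod.map id f)) :=
    onRegister_submatrix_reindexMap (h := id) (fun _ => rfl) S _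
  have hA : (onRegister (splitAliceOneWay A B C A') T (ketBra G.ψ ⊗ₖ ρ)).submatrix
        (Prod.map id f) (Prod.map id f) =
      onRegister (splitAliceOneWay A B C _) (reindexMap fA T) (ketBra G.ψ ⊗ₖ ρ.submatrix f f) :=
    onRegister_submatrix_reindexMap (h := id) (fun _ => rfl) T _
  have h := G.acceptProb_le_oneWayValue_of_fin (hT.reindexMap fA) (hS.reindexMap fB)
    (hρ.submatrix_equiv f)
  rwa [← G.acceptProb_submatrix f, hB, hA]

end Values

end RankOneGame

/-- `B` against the rest in the system `A B C E`. -/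
def isolateBob (A B C E : Type*) : (A × B × C) × E ≃ B × (A × C × E) where
  toFun x := (x.1.2.1, (x.1.1, x.1.2.2, x.2))
  invFun y := ((y.2.1, y.1, y.2.2.1), y.2.2.2)
  left_inv _ := rfl
  right_inv _ := rfl

/-- The exchange of two registers `ℂ^R`, in the presence of a register `ℂ^E`. -/
def swapFirstTwo (R E : Type*) : R × R × E ≃ R × R × E where
  toFun x := (x.2.1, x.1, x.2.2)
  invFun x := (x.2.1, x.1, x.2.2)
  left_inv _ := rfl
  right_inv _ := rfl

theorem depolarize_ketBra_tensorVec_alice {A B C E : Type*} [Fintype A] [DecidableEq A]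
    (v : EuclideanSpace ℂ (A × B × C)) (η : EuclideanSpace ℂ E) :
    depolarize (Equiv.prodAssoc A (B × C) E) (ketBra (tensorVec v η)) =
      ((maximallyMixed A ⊗ₖ ketBra η) ⊗ₖ
        partialTrace (Equiv.refl (A × B × C)) (ketBra v)).submatrix
          (splitAliceOneWay A B C E) (splitAliceOneWay A B C E) := by
  ext ⟨⟨a, b, c⟩, i⟩ ⟨⟨a', b', c'⟩, i'⟩
  have h : partialTrace (Equiv.prodAssoc A (B × C) E) (ketBra (tensorVec v η)) =
      partialTrace (Equiv.refl (A × B × C)) (ketBra v) ⊗ₖ ketBra η := by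
    rw [ketBra_tensorVec]
    ext u w
    simp [partialTrace_apply, Finset.sum_mul]
  rw [depolarize, h]
  exact (congrArg _ (mul_comm _ _)).trans (mul_assoc (maximallyMixed A a a') _ _).symm

namespace RankOneGame

section Optimality

variable {A B C : Type*} [Fintype A] [Fintype B] [Fintype C] (G : RankOneGame A B C)

theorem acceptProb_le_card_sq_mul_acceptProb_depolarize {R E E' : Type*} [Fintype R]
    [DecidableEq R] [Fintype E] [DecidableEq E] (e : (A × B × C) × E ≃ R × E')
    {L : Matrix ((A × B × C) × E) ((A × B × C) × E) ℂ →ₗ[ℂ]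
      Matrix ((A × B × C) × E) ((A × B × C) × E) ℂ}
    (hL : IsQuantumOperation L) {X : Matrix ((A × B × C) × E) ((A × B × C) × E) ℂ}
    (hX : X.PosSemidef) :
    G.acceptProb (L X) ≤ (Fintype.card R : ℝ) ^ 2 * G.acceptProb (L (depolarize e X)) :=
  re_map_le_card_sq_mul_re_map_depolarize e (G.acceptMap E ∘ₗ L)
    (fun _ hY => G.acceptProb_nonneg (hL.posSemidef_map hY)) hX

theorem acceptProb_onRegister_splitBobOneWay_le_entangledValue {E : Type*} [Fintype E]
    [DecidableEq E]
    {S : Matrix (B × E) (B × E) ℂ →ₗ[ℂ] Matrix (B × E) (B × E) ℂ}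
    (hS : IsQuantumOperation S) {ρ : Matrix (A × E) (A × E) ℂ} (hρ : IsDensity ρ) :
    G.acceptProb (onRegister (splitBobOneWay A B C E) S
      ((ρ ⊗ₖ partialTrace (Equiv.refl (A × B × C)) (ketBra G.ψ)).submatrix
        (splitAliceOneWay A B C E) (splitAliceOneWay A B C E))) ≤ G.entangledValue := by
  classical
  -- The state `ρ` of Alice's answer and her message is shared in advance; Alice swaps her share of
  -- it for her question, which is then discarded.
  let T := (Matrix.reindexLinearEquiv ℂ ℂ (Equiv.prodComm A A) (Equiv.prodComm A A)).toLinearMap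
  let X := onRegister (splitBobEnt A B C A E) S (ketBra G.ψ ⊗ₖ ρ)
  let swap : (A × B × C) × (A × E) ≃ (A × B × C) × (A × E) :=
    ⟨fun x => ((x.2.1, x.1.2), (x.1.1, x.2.2)), fun x => ((x.2.1, x.1.2), (x.1.1, x.2.2)),
      fun _ => rfl, fun _ => rfl⟩
  let keepShare : (A × B × C) × (A × E) ≃ A × ((A × B × C) × E) :=
    ⟨fun x => (x.1.1, ((x.2.1, x.1.2), x.2.2)), fun y => ((y.1, y.2.1.2), (y.2.1.1, y.2.2)),
      fun _ => rfl, fun _ => rfl⟩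
  have hdiscard : partialTrace keepShare (ketBra G.ψ ⊗ₖ ρ) =
      (ρ ⊗ₖ partialTrace (Equiv.refl (A × B × C)) (ketBra G.ψ)).submatrix
        (splitAliceOneWay A B C E) (splitAliceOneWay A B C E) := by
    ext x y
    simp [partialTrace_apply, keepShare, splitAliceOneWay, Finset.mul_sum, mul_comm]
  have hX : partialTrace keepShare X = onRegister (splitBobOneWay A B C E) S
      ((ρ ⊗ₖ partialTrace (Equiv.refl (A × B × C)) (ketBra G.ψ)).submatrix
        (splitAliceOneWay A B C E) (splitAliceOneWay A B C E)) := by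
    rw [← hdiscard]
    exact partialTrace_onRegister_of_disjoint (h := fun a u => (a, u.2, u.1)) (fun _ _ => rfl) S _
  have hswap : onRegister (splitAliceEnt A B C A E) T X = X.submatrix swap swap := rfl
  have h := G.acceptProb_le_entangledValue
    (isQuantumOperation_reindexLinearEquiv (Equiv.prodComm A A)) hS hρ
  rwa [← hX, ← partialTrace_submatrix keepShare swap, ← hswap,
    G.acceptProb_partialTrace (Equiv.refl (A × E)) fun _ _ _ => rfl]

theorem oneWayValue_le_card_sq_mul_entangledValue :
    G.oneWayValue ≤ (Fintype.card A : ℝ) ^ 2 * G.entangledValue := by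
  classical
  have := G.nonempty_alice
  refine Real.sSup_le ?_ (mul_nonneg (sq_nonneg _) G.entangledValue_nonneg)
  rintro _ ⟨k, T, S, hT, hS, rfl⟩
  refine (G.acceptProb_le_card_sq_mul_acceptProb_depolarize (Equiv.prodAssoc A (B × C) _)
    ((hS.registerMap _).comp (hT.registerMap _)) (posSemidef_ketBra _)).trans ?_
  rw [depolarize_ketBra_tensorVec_alice, LinearMap.comp_apply, registerMap_apply,
    registerMap_apply, onRegister_kronecker]
  gcongr
  exact G.acceptProb_onRegister_splitBobOneWay_le_entangledValue hS
    (hT.isDensity_map (isDensity_maximallyMixed.kronecker (isDensity_ketBra (by simp))))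

theorem acceptProb_onRegister_splitJoint_depolarize_le_oneWayValue [DecidableEq B] {E : Type*}
    [Fintype E] [DecidableEq E]
    {T : Matrix (A × B × E) (A × B × E) ℂ →ₗ[ℂ] Matrix (A × B × E) (A × B × E) ℂ}
    (hT : IsQuantumOperation T) {η : EuclideanSpace ℂ E} (hη : ‖η‖ = 1) :
    G.acceptProb (onRegister (splitJoint A B C E) T
      (depolarize (isolateBob A B C E) (ketBra (tensorVec G.ψ η)))) ≤ G.oneWayValue := by
  have := G.nonempty_bob
  -- Alice prepares a maximally mixed register in place of Bob's question, applies `T`, and sends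
  -- Bob his answer, which he swaps for his question.
  let S := (Matrix.reindexLinearEquiv ℂ ℂ (swapFirstTwo B E) (swapFirstTwo B E)).toLinearMap
  let X := onRegister (splitAliceOneWay A B C (B × E)) T
    (ketBra G.ψ ⊗ₖ (maximallyMixed B ⊗ₖ ketBra η))
  let swap : (A × B × C) × (B × E) ≃ (A × B × C) × (B × E) :=
    ⟨fun x => ((x.1.1, x.2.1, x.1.2.2), (x.1.2.1, x.2.2)),
      fun x => ((x.1.1, x.2.1, x.1.2.2), (x.1.2.1, x.2.2)), fun _ => rfl, fun _ => rfl⟩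
  let keepMessage : (A × B × C) × (B × E) ≃ B × ((A × B × C) × E) :=
    ⟨fun x => (x.1.2.1, ((x.1.1, x.2.1, x.1.2.2), x.2.2)),
      fun y => ((y.2.1.1, y.1, y.2.1.2.2), (y.2.1.2.1, y.2.2)), fun _ => rfl, fun _ => rfl⟩
  have hdiscard : partialTrace keepMessage (ketBra G.ψ ⊗ₖ (maximallyMixed B ⊗ₖ ketBra η)) =
      depolarize (isolateBob A B C E) (ketBra (tensorVec G.ψ η)) := by
    rw [ketBra_tensorVec]
    ext x y
    simp [depolarize, partialTrace_apply, keepMessage, isolateBob, Finset.mul_sum,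
      mul_left_comm]
  have hX : partialTrace keepMessage X = onRegister (splitJoint A B C E) T
      (depolarize (isolateBob A B C E) (ketBra (tensorVec G.ψ η))) := by
    rw [← hdiscard]
    exact partialTrace_onRegister_of_disjoint (h := fun b c => (b, c)) (fun _ _ => rfl) T _
  have hswap : onRegister (splitBobOneWay A B C (B × E)) S X = X.submatrix swap swap := rfl
  have h := G.acceptProb_le_oneWayValue hT
    (isQuantumOperation_reindexLinearEquiv (swapFirstTwo B E))
    (isDensity_maximallyMixed.kronecker (isDensity_ketBra hη))
  rwa [← hX, ← partialTrace_submatrix keepMessage swap, ← hswap,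
    G.acceptProb_partialTrace (Equiv.refl (B × E)) fun _ _ _ => rfl]

theorem maximalValue_le_card_sq_mul_oneWayValue :
    G.maximalValue ≤ (Fintype.card B : ℝ) ^ 2 * G.oneWayValue := by
  classical
  refine Real.sSup_le ?_ (mul_nonneg (sq_nonneg _) G.oneWayValue_nonneg)
  rintro _ ⟨k, η, T, hη, hT, rfl⟩
  refine (G.acceptProb_le_card_sq_mul_acceptProb_depolarize (isolateBob A B C (Fin k))
    (hT.registerMap _) (posSemidef_ketBra _)).trans ?_
  gcongr
  exact G.acceptProb_onRegister_splitJoint_depolarize_le_oneWayValue hT hη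

end Optimality

end RankOneGame

section MaximallyEntangled

variable {n : ℕ}

theorem uniformState_apply {ι : Type*} [DecidableEq ι] (f : Fin n → ι) (x : ι) :
    uniformState n f x = ((Real.sqrt n : ℝ) : ℂ)⁻¹ * ∑ i, if x = f i then 1 else 0 := by
  simp [uniformState, Pi.single_apply]

/-- The maximally entangled vector `n^{-1/2} ∑ᵢ |ii⟩`. -/
def maxEntangled (n : ℕ) : EuclideanSpace ℂ (Fin n × Fin n) :=
  uniformState n fun i => (i, i)

theorem maxEntangled_apply (i j : Fin n) :
    maxEntangled n (i, j) = ((Real.sqrt n : ℝ) : ℂ)⁻¹ * if i = j then 1 else 0 := by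
  simp [maxEntangled, uniformState_apply, ite_and, eq_comm]

theorem ketBra_maxEntangled_apply (i j k l : Fin n) :
    ketBra (maxEntangled n) (i, j) (k, l) =
      (n : ℂ)⁻¹ * ((if i = j then 1 else 0) * if k = l then 1 else 0) := by
  have hsqrt : ((Real.sqrt n : ℝ) : ℂ)⁻¹ * ((Real.sqrt n : ℝ) : ℂ)⁻¹ = (n : ℂ)⁻¹ := by
    rw [← mul_inv, ← Complex.ofReal_mul, Real.mul_self_sqrt n.cast_nonneg, Complex.ofReal_natCast]
  by_cases hij : i = j <;> by_cases hkl : k = l <;>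
    simp [ketBra_apply, maxEntangled_apply, hij, hkl, hsqrt]

theorem partialTrace_ketBra_maxEntangled :
    partialTrace (Equiv.refl (Fin n × Fin n)) (ketBra (maxEntangled n)) =
      maximallyMixed (Fin n) := by
  ext i j
  simp [partialTrace_apply, ketBra_maxEntangled_apply, maximallyMixed, Matrix.one_apply, eq_comm]

theorem trace_ketBra_maxEntangled_mul_kronecker_maximallyMixed (β : Matrix (Fin n) (Fin n) ℂ) :
    (ketBra (maxEntangled n) * (β ⊗ₖ maximallyMixed (Fin n))).trace = β.trace / (n : ℂ) ^ 2 := by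
  have h : (ketBra (maxEntangled n) * (β ⊗ₖ maximallyMixed (Fin n))).trace =
      ∑ i, (n : ℂ)⁻¹ * (β i i * (n : ℂ)⁻¹) := by
    simp [Matrix.trace, Matrix.mul_apply, ketBra_maxEntangled_apply, maximallyMixed,
      Fintype.sum_prod_type, Matrix.one_apply]
  rw [h, Matrix.trace, Finset.sum_div]
  refine Finset.sum_congr rfl fun i _ => ?_
  rw [Matrix.diag_apply, div_eq_mul_inv, sq, mul_inv]
  ring

end MaximallyEntangled

section ProductUpperBound

variable {n : ℕ}

/-- `M E` against `C` in the system `M C E`. -/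
def splitMiddle (M C E : Type*) : M × C × E ≃ (M × E) × C where
  toFun x := ((x.1, x.2.2), x.2.1)
  invFun y := (y.1.1, y.2, y.1.2)
  left_inv _ := rfl
  right_inv _ := rfl

/-- `E` against `M C` in the system `M C E`. -/
def splitLast (M C E : Type*) : M × C × E ≃ E × (M × C) where
  toFun x := (x.2.2, (x.1, x.2.1))
  invFun y := (y.2.1, y.2.2, y.1)
  left_inv _ := rfl
  right_inv _ := rfl

/-- `B` against the rest in the system `A B C`. -/
def bobFirst (A B C : Type*) : A × B × C ≃ B × (A × C) where
  toFun x := (x.2.1, (x.1, x.2.2))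
  invFun y := (y.2.1, y.1, y.2.2)
  left_inv _ := rfl
  right_inv _ := rfl

theorem kronecker_submatrix_splitMiddle {M C E : Type*} (X : Matrix M M ℂ) (Y : Matrix C C ℂ)
    (Z : Matrix E E ℂ) :
    ((X ⊗ₖ Z) ⊗ₖ Y).submatrix (splitMiddle M C E) (splitMiddle M C E) =
      ((X ⊗ₖ Y) ⊗ₖ Z).submatrix (Equiv.prodAssoc M C E).symm (Equiv.prodAssoc M C E).symm := by
  ext x y
  exact mul_right_comm _ _ _

theorem partialTrace_splitAliceEnt_kronecker {A B C A' B' : Type*} [Fintype A] [Fintype A']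
    (X : Matrix (A × B × C) (A × B × C) ℂ) (Y : Matrix (A' × B') (A' × B') ℂ) :
    partialTrace (splitAliceEnt A B C A' B') (X ⊗ₖ Y) =
      (partialTrace (Equiv.refl (A × B × C)) X ⊗ₖ
        partialTrace (Equiv.refl (A' × B')) Y).submatrix
          (Equiv.prodAssoc B C B').symm (Equiv.prodAssoc B C B').symm := by
  ext x y
  simp [partialTrace_apply, splitAliceEnt, Fintype.sum_prod_type, Finset.sum_mul_sum]

theorem partialTrace_isolateBob_kronecker {A B C E : Type*} [Fintype B]
    (X : Matrix (A × B × C) (A × B × C) ℂ) (Y : Matrix E E ℂ) :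
    partialTrace (isolateBob A B C E) (X ⊗ₖ Y) =
      (partialTrace (bobFirst A B C) X ⊗ₖ Y).submatrix
        (Equiv.prodAssoc A C E).symm (Equiv.prodAssoc A C E).symm := by
  ext x y
  simp [partialTrace_apply, isolateBob, bobFirst, Finset.sum_mul]

theorem partialTrace_partialTrace_splitAliceEnt {A B C A' B' : Type*} [Fintype A] [Fintype A']
    [Fintype B'] (X : Matrix ((A × B × C) × (A' × B')) ((A × B × C) × (A' × B')) ℂ) :
    partialTrace (splitLast B C B') (partialTrace (splitAliceEnt A B C A' B') X) =
      partialTrace (Equiv.refl (A × B × C)) (partialTrace (Equiv.prodComm _ _) X) := by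
  let q : (A × B × C) × (A' × B') ≃ ((A × A') × B') × (B × C) :=
    ⟨fun x => (((x.1.1, x.2.1), x.2.2), x.1.2), fun y => ((y.1.1.1, y.2), (y.1.1.2, y.1.2)),
      fun _ => rfl, fun _ => rfl⟩
  let g : (A' × B') × A ≃ (A × A') × B' :=
    ⟨fun x => ((x.2, x.1.1), x.1.2), fun y => ((y.1.2, y.2), y.1.1), fun _ => rfl, fun _ => rfl⟩
  rw [partialTrace_partialTrace (q := q) (Equiv.refl _) fun _ _ _ => rfl,
    partialTrace_partialTrace (q := q) g fun _ _ _ => rfl]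

theorem partialTrace_splitLast_kronecker {M C E : Type*} [Fintype E]
    (β : Matrix (M × E) (M × E) ℂ) (Y : Matrix C C ℂ) :
    partialTrace (splitLast M C E)
        ((β ⊗ₖ Y).submatrix (splitMiddle M C E) (splitMiddle M C E)) =
      partialTrace (Equiv.prodComm M E) β ⊗ₖ Y := by
  ext x y
  simp [partialTrace_apply, splitLast, splitMiddle, Finset.sum_mul]

theorem trace_ketBra_maxEntangled_mul_partialTrace_onRegister {E : Type*} [Fintype E]
    {T : Matrix (Fin n × E) (Fin n × E) ℂ →ₗ[ℂ] Matrix (Fin n × E) (Fin n × E) ℂ}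
    (hT : IsQuantumOperation T) {η : Matrix (Fin n × E) (Fin n × E) ℂ} (hη : IsDensity η) :
    (ketBra (maxEntangled n) * partialTrace (splitLast (Fin n) (Fin n) E)
      (onRegister (splitMiddle (Fin n) (Fin n) E) T
        ((η ⊗ₖ maximallyMixed (Fin n)).submatrix (splitMiddle (Fin n) (Fin n) E)
          (splitMiddle (Fin n) (Fin n) E)))).trace.re = 1 / (n : ℝ) ^ 2 := by
  rw [onRegister_kronecker, partialTrace_splitLast_kronecker,
    trace_ketBra_maxEntangled_mul_kronecker_maximallyMixed, trace_partialTrace,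
    hT.tracePreserving, hη.trace_eq_one, ← Complex.ofReal_natCast, ← Complex.ofReal_pow,
    ← Complex.ofReal_one, ← Complex.ofReal_div, Complex.ofReal_re]

end ProductUpperBound

section Games

variable {n : ℕ} [NeZero n]

theorem gameC_ψ_apply (a b c : Fin n) :
    (gameC n).ψ (a, b, c) =
      EuclideanSpace.single (0 : Fin n) (1 : ℂ) b * maxEntangled n (a, c) := by
  by_cases hb : b = 0 <;> simp [maxEntangled, uniformState_apply, gameC, hb]

theorem gameC_γ_apply (a b c : Fin n) :
    (gameC n).γ (a, b, c) =
      EuclideanSpace.single (0 : Fin n) (1 : ℂ) a * maxEntangled n (b, c) := by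
  by_cases ha : a = 0 <;> simp [maxEntangled, uniformState_apply, gameC, ha]

theorem gameR_ψ : (gameR n).ψ = (gameC n).γ := rfl

theorem gameR_γ : (gameR n).γ = (gameC n).ψ := rfl

theorem oneWayValue_gameC : (gameC n).oneWayValue = 1 := by
  refine (gameC n).oneWayValue_le_one.antisymm ?_
  let T := (Matrix.reindexLinearEquiv ℂ ℂ (Equiv.prodComm (Fin n) (Fin n))
    (Equiv.prodComm (Fin n) (Fin n))).toLinearMap
  have hT : IsQuantumOperation T := isQuantumOperation_reindexLinearEquiv _
  let e₀ : EuclideanSpace ℂ (Fin n) := EuclideanSpace.single 0 1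
  have he₀ : ‖e₀‖ = 1 := by simp [e₀]
  have hfinal : onRegister (splitBobOneWay (Fin n) (Fin n) (Fin n) (Fin n)) T
      (onRegister (splitAliceOneWay (Fin n) (Fin n) (Fin n) (Fin n)) T
        (ketBra (gameC n).ψ ⊗ₖ ketBra e₀)) = ketBra (tensorVec (gameC n).γ e₀) := by
    have hvec (a b c i : Fin n) : (gameC n).ψ (b, i, c) * e₀ a = (gameC n).γ (a, b, c) * e₀ i := by
      rw [gameC_ψ_apply, gameC_γ_apply]
      ring
    rw [← ketBra_tensorVec]
    ext ⟨⟨a, b, c⟩, i⟩ ⟨⟨a', b', c'⟩, i'⟩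
    exact congrArg₂ (fun z w => z * star w) (hvec a b c i) (hvec a' b' c' i')
  have h := (gameC n).acceptProb_le_oneWayValue hT hT (isDensity_ketBra he₀)
  rwa [hfinal, (gameC n).acceptProb_ketBra_γ he₀] at h

theorem maximalValue_gameR : (gameR n).maximalValue = 1 := by
  refine (gameR n).maximalValue_le_one.antisymm ?_
  let σ := swapFirstTwo (Fin n) (Fin 1)
  let T := (Matrix.reindexLinearEquiv ℂ ℂ σ σ).toLinearMap
  let e₀ : EuclideanSpace ℂ (Fin 1) := EuclideanSpace.single 0 1
  have he₀ : ‖e₀‖ = 1 := by simp [e₀]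
  have hfinal : onRegister (splitJoint (Fin n) (Fin n) (Fin n) (Fin 1)) T
      (ketBra (tensorVec (gameR n).ψ e₀)) = ketBra (tensorVec (gameR n).γ e₀) := by
    have hvec (a b c : Fin n) : (gameR n).ψ (b, a, c) = (gameR n).γ (a, b, c) := by
      rw [gameR_ψ, gameR_γ, gameC_ψ_apply, gameC_γ_apply]
    ext ⟨⟨a, b, c⟩, i⟩ ⟨⟨a', b', c'⟩, i'⟩
    exact congrArg₂ (fun z w => z * e₀ i * star (w * e₀ i')) (hvec a b c) (hvec a' b' c')
  refine le_csSup (gameR n).bddAbove_jointProbs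
    ⟨1, e₀, T, he₀, isQuantumOperation_reindexLinearEquiv σ, ?_⟩
  rw [hfinal, (gameR n).acceptProb_ketBra_γ he₀]

theorem partialTrace_ketBra_gameC_ψ :
    partialTrace (Equiv.refl (Fin n × Fin n × Fin n)) (ketBra (gameC n).ψ) =
      ketBra (EuclideanSpace.single (0 : Fin n) (1 : ℂ)) ⊗ₖ maximallyMixed (Fin n) := by
  rw [← partialTrace_ketBra_maxEntangled]
  ext ⟨b, c⟩ ⟨b', c'⟩
  by_cases hb : b = 0 <;> by_cases hb' : b' = 0 <;>
    simp [partialTrace_apply, ketBra_apply, gameC_ψ_apply, hb, hb']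

theorem partialTrace_ketBra_gameR_ψ :
    partialTrace (bobFirst (Fin n) (Fin n) (Fin n)) (ketBra (gameR n).ψ) =
      ketBra (EuclideanSpace.single (0 : Fin n) (1 : ℂ)) ⊗ₖ maximallyMixed (Fin n) := by
  rw [← partialTrace_ketBra_maxEntangled]
  ext ⟨a, c⟩ ⟨a', c'⟩
  by_cases ha : a = 0 <;> by_cases ha' : a' = 0 <;>
    simp [partialTrace_apply, ketBra_apply, gameR_ψ, gameC_γ_apply, bobFirst, ha, ha']

theorem entangledValue_gameC_le : (gameC n).entangledValue ≤ 1 / (n : ℝ) ^ 2 := by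
  refine Real.sSup_le ?_ (by positivity)
  rintro _ ⟨k, l, φ, T, S, hφ, hT, hS, rfl⟩
  let X := ketBra (tensorVec (gameC n).ψ φ)
  let Y := onRegister (splitBobEnt (Fin n) (Fin n) (Fin n) (Fin k) (Fin l)) S X
  have hYpos : Y.PosSemidef := hS.posSemidef_onRegister _ (posSemidef_ketBra _)
  let eA := splitAliceEnt (Fin n) (Fin n) (Fin n) (Fin k) (Fin l)
  let σ := partialTrace (Equiv.refl (Fin k × Fin l)) (ketBra φ)
  have he₀ : ‖(EuclideanSpace.single (0 : Fin n) (1 : ℂ))‖ = 1 := by simp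
  have hσ : IsDensity σ := (isDensity_ketBra hφ).partialTrace _
  have hreduce : partialTrace (Equiv.refl (Fin n × Fin n × Fin n))
      (partialTrace (Equiv.prodComm _ _) (onRegister eA T Y)) =
      partialTrace (splitLast (Fin n) (Fin n) (Fin l)) (partialTrace eA Y) := by
    rw [← hT.partialTrace_onRegister eA Y, partialTrace_partialTrace_splitAliceEnt]
  have hY : partialTrace eA Y = onRegister (splitMiddle (Fin n) (Fin n) (Fin l)) S
      (((ketBra (EuclideanSpace.single 0 1) ⊗ₖ σ) ⊗ₖ maximallyMixed (Fin n)).submatrix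
        (splitMiddle (Fin n) (Fin n) (Fin l)) (splitMiddle (Fin n) (Fin n) (Fin l))) := by
    rw [kronecker_submatrix_splitMiddle, ← partialTrace_ketBra_gameC_ψ,
      ← partialTrace_splitAliceEnt_kronecker, ← ketBra_tensorVec]
    exact partialTrace_onRegister_of_disjoint (h := fun a u => (a.1, u, a.2)) (fun _ _ => rfl) S X
  have h := (gameC n).acceptProb_le_of_γ_eq (Equiv.refl _) (α := EuclideanSpace.single 0 1)
    he₀ (fun x => gameC_γ_apply x.1 x.2.1 x.2.2)
    (hT.posSemidef_onRegister eA hYpos)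
  rwa [hreduce, hY, trace_ketBra_maxEntangled_mul_partialTrace_onRegister hS
    ((isDensity_ketBra he₀).kronecker hσ)] at h

theorem oneWayValue_gameR_le : (gameR n).oneWayValue ≤ 1 / (n : ℝ) ^ 2 := by
  refine Real.sSup_le ?_ (by positivity)
  rintro _ ⟨k, T, S, hT, hS, rfl⟩
  let e₀ : EuclideanSpace ℂ (Fin (k + 1)) := EuclideanSpace.single 0 1
  have he₀ : ‖(EuclideanSpace.single (0 : Fin n) (1 : ℂ))‖ = 1 := by simp
  let X := ketBra (tensorVec (gameR n).ψ e₀)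
  let Y := onRegister (splitAliceOneWay (Fin n) (Fin n) (Fin n) (Fin (k + 1))) T X
  have hYpos : Y.PosSemidef := hT.posSemidef_onRegister _ (posSemidef_ketBra _)
  let eB := splitBobOneWay (Fin n) (Fin n) (Fin n) (Fin (k + 1))
  let eB' := isolateBob (Fin n) (Fin n) (Fin n) (Fin (k + 1))
  have hreduce : partialTrace (bobFirst (Fin n) (Fin n) (Fin n))
      (partialTrace (Equiv.prodComm _ _) (onRegister eB S Y)) =
      partialTrace (splitLast (Fin n) (Fin n) (Fin (k + 1))) (partialTrace eB' Y) := by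
    rw [partialTrace_partialTrace (q := eB) (Equiv.prodComm _ _) fun _ _ _ => rfl,
      hS.partialTrace_onRegister,
      partialTrace_partialTrace (q := eB) (Equiv.refl _) fun _ _ _ => rfl]
  have hY : partialTrace eB' Y = onRegister (splitMiddle (Fin n) (Fin n) (Fin (k + 1))) T
      (((ketBra (EuclideanSpace.single 0 1) ⊗ₖ ketBra e₀) ⊗ₖ maximallyMixed (Fin n)).submatrix
        (splitMiddle (Fin n) (Fin n) (Fin (k + 1)))
        (splitMiddle (Fin n) (Fin n) (Fin (k + 1)))) := by
    rw [kronecker_submatrix_splitMiddle, ← partialTrace_ketBra_gameR_ψ,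
      ← partialTrace_isolateBob_kronecker, ← ketBra_tensorVec]
    exact partialTrace_onRegister_of_disjoint (h := fun b c => (b, c)) (fun _ _ => rfl) T X
  have h := (gameR n).acceptProb_le_of_γ_eq (bobFirst _ _ _) (α := EuclideanSpace.single 0 1)
    he₀ (fun x => gameC_ψ_apply x.1 x.2.1 x.2.2)
    (hS.posSemidef_onRegister eB hYpos)
  rwa [hreduce, hY, trace_ketBra_maxEntangled_mul_partialTrace_onRegister hT
    ((isDensity_ketBra he₀).kronecker (isDensity_ketBra (v := e₀) (by simp [e₀])))] at h

theorem entangledValue_gameC : (gameC n).entangledValue = 1 / (n : ℝ) ^ 2 := by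
  refine entangledValue_gameC_le.antisymm ?_
  have hn : (0 : ℝ) < (n : ℝ) ^ 2 := by have := NeZero.pos n; positivity
  have h := (gameC n).oneWayValue_le_card_sq_mul_entangledValue
  rw [oneWayValue_gameC, Fintype.card_fin] at h
  rwa [div_le_iff₀' hn]

theorem oneWayValue_gameR : (gameR n).oneWayValue = 1 / (n : ℝ) ^ 2 := by
  refine oneWayValue_gameR_le.antisymm ?_
  have hn : (0 : ℝ) < (n : ℝ) ^ 2 := by have := NeZero.pos n; positivity
  have h := (gameR n).maximalValue_le_card_sq_mul_oneWayValue
  rw [maximalValue_gameR, Fintype.card_fin] at h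
  rwa [div_le_iff₀' hn]

end Games

end QuantumGame

end

theorem mainTheorem5_general (n : ℕ) [NeZero n] :
    (QuantumGame.gameC n).oneWayValue / (QuantumGame.gameC n).entangledValue = (n : ℝ) ^ 2 ∧
    (QuantumGame.gameR n).maximalValue / (QuantumGame.gameR n).oneWayValue = (n : ℝ) ^ 2 ∧
    ∀ {A B C : Type*} [Fintype A] [Fintype B] [Fintype C] (G : QuantumGame.RankOneGame A B C),
      G.oneWayValue ≤ (Fintype.card A : ℝ) ^ 2 * G.entangledValue ∧
      G.maximalValue ≤ (Fintype.card B : ℝ) ^ 2 * G.oneWayValue := by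
  refine ⟨?_, ?_, fun G => ⟨G.oneWayValue_le_card_sq_mul_entangledValue,
    G.maximalValue_le_card_sq_mul_oneWayValue⟩⟩
  · rw [QuantumGame.oneWayValue_gameC, QuantumGame.entangledValue_gameC, one_div_one_div]
  · rw [QuantumGame.maximalValue_gameR, QuantumGame.oneWayValue_gameR, one_div_one_div]

theorem mainTheorem5 (n : ℕ) [NeZero n] :
    (QuantumGame.gameC n).oneWayValue / (QuantumGame.gameC n).entangledValue = (n : ℝ) ^ 2 ∧
    (QuantumGame.gameR n).maximalValue / (QuantumGame.gameR n).oneWayValue = (n : ℝ) ^ 2 ∧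
    ∀ (c : ℕ) (G : QuantumGame.RankOneGame (Fin n) (Fin n) (Fin c)),
      G.oneWayValue ≤ (n : ℝ) ^ 2 * G.entangledValue ∧
      G.maximalValue ≤ (n : ℝ) ^ 2 * G.oneWayValue := by
  obtain ⟨hC, hR, hoptimal⟩ := mainTheorem5_general n
  exact ⟨hC, hR, fun c G => by simpa only [Fintype.card_fin] using hoptimal G⟩
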